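/- For every $n$, let $\sigma_n>0$, let $\Phi=\Phi_n$ be a real $n\times k_n$ matrix with linearly independent columns (so $k_n\le n$; no other restriction is put on $k_n$), and let $F_0=F_{0,n}\in\mathbb R^n$ be arbitrary (it need not lie in the column span of $\Phi$). The observation $Y$ takes values in $\mathbb R^n$ and is modelled as $Y\sim\mathcal N(F,\sigma_n^2I_n)$ with $F=\Phi\theta$, $\theta\in\mathbb R^{k_n}$. Let $\widetilde W=\widetilde W_n$ be a prior probability distribution of $\theta$ with density $w=w_n$ with respect to Lebesgue measure on $\mathbb R^{k_n}$, let $W$ be the induced prior of $F=\Phi\theta$ on $\mathbb R^n$, and let $W(dF\mid Y)$ be the posterior distribution of $F$ given $Y$. Put $\theta_0=(\Phi^T\Phi)^{-1}\Phi^TF_0$, $\Pi=\Phi(\Phi^T\Phi)^{-1}\Phi^T$ and $Y_\Phi=\Pi Y$. Suppose that there is a real sequence $(M_n)$ with $M_n\to\infty$ such that, as $n\to\infty$, 1. $\displaystyle\sup_{\|\Phi h\|^2\le\sigma_n^2M_n,\ \|\Phi g\|^2\le\sigma_n^2M_n}\frac{w(\theta_0+h)}{w(\theta_0+g)}\to1$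 (in particular $w>0$ on $\{\theta_0+h:\|\Phi h\|^2\le\sigma_n^2M_n\}$ for all large $n$); 2. $k_n\ln k_n=o(M_n)$; 3. $\displaystyle\max\Bigl(0,\ \ln\frac{\sqrt{\det(\Phi^T\Phi)}}{\sigma_n^{k_n}\,w(\theta_0)}\Bigr)=o(M_n)$. Then $$\mathbb E\,\bigl\|W(dF\mid Y)-\mathcal N(Y_\Phi,\sigma_n^2\Pi)\bigr\|_{\mathrm{TV}}\to0\qquad(n\to\infty),$$ where the expectation is under $Y\sim\mathcal N(F_0,\sigma_n^2I_n)$ and $\|P-Q\|_{\mathrm{TV}}=\sup_A|P(A)-Q(A)|$. -/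

import Mathlib

open MeasureTheory ProbabilityTheory Filter Topology Asymptotics
open scoped NNReal ENNReal Matrix

namespace GaussianRegression

noncomputable section

/-- Total variation distance between two (probability) measures,
`sup_A |P(A) - Q(A)|` over all measurable sets `A`. -/
def tvDist {α : Type*} [MeasurableSpace α] (P Q : Measure α) : ℝ≥0∞ :=
  ⨆ (A : Set α) (_ : MeasurableSet A), ENNReal.ofReal |P.real A - Q.real A|

/-- The linear map `θ ↦ Φ θ` between Euclidean spaces. -/
def design {n k : ℕ} (Φ : Matrix (Fin n) (Fin k) ℝ) :
    EuclideanSpace ℝ (Fin k) →ₗ[ℝ] EuclideanSpace ℝ (Fin n) :=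
  Matrix.toEuclideanLin Φ

/-- The parameter `(ΦᵀΦ)⁻¹ Φᵀ y` of the projection of `y` onto the span of the columns of `Φ`.
With `y = F₀` this is `θ₀`, with `y = Y` it is the maximum likelihood estimator of `θ`. -/
def projParam {n k : ℕ} (Φ : Matrix (Fin n) (Fin k) ℝ) (y : EuclideanSpace ℝ (Fin n)) :
    EuclideanSpace ℝ (Fin k) :=
  Matrix.toEuclideanLin ((Φᵀ * Φ)⁻¹ * Φᵀ) y

/-- The matrix `Φ (ΦᵀΦ)⁻¹ Φᵀ` of the orthogonal projection onto the column span of `Φ`. -/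
def projMatrix {n k : ℕ} (Φ : Matrix (Fin n) (Fin k) ℝ) : Matrix (Fin n) (Fin n) ℝ :=
  Φ * (Φᵀ * Φ)⁻¹ * Φᵀ

/-- The ellipsoid of increments `{h : ‖Φ h‖² ≤ σ² M}`. -/
def ellipsoid {n k : ℕ} (Φ : Matrix (Fin n) (Fin k) ℝ) (σ M : ℝ) :
    Set (EuclideanSpace ℝ (Fin k)) :=
  {h | ‖design Φ h‖ ^ 2 ≤ σ ^ 2 * M}

/-- The supremum of `w (θ₀ + h) / w (θ₀ + g)` over `h, g` in a set `E`, in `[0, ∞]`.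
The quotient is `∞` where only the denominator vanishes, and `0 / 0 = 0`. -/
def oscRatio {k : ℕ} (w : EuclideanSpace ℝ (Fin k) → ℝ≥0) (θ₀ : EuclideanSpace ℝ (Fin k))
    (E : Set (EuclideanSpace ℝ (Fin k))) : ℝ≥0∞ :=
  ⨆ h ∈ E, ⨆ g ∈ E, (w (θ₀ + h) : ℝ≥0∞) / (w (θ₀ + g) : ℝ≥0∞)

/-- The law `N(F, S)` depends measurably on its mean `F`. -/
theorem measurable_multivariateGaussian {n : ℕ} (S : Matrix (Fin n) (Fin n) ℝ) :
    Measurable fun F : EuclideanSpace ℝ (Fin n) => multivariateGaussian F S := by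
  refine Measure.measurable_of_measurable_coe _ fun s hs => ?_
  unfold multivariateGaussian
  generalize Matrix.toEuclideanCLM (n := Fin n) (𝕜 := ℝ) _ = L
  have hm : Measurable fun p : EuclideanSpace ℝ (Fin n) × EuclideanSpace ℝ (Fin n) =>
      p.1 + L p.2 := by fun_prop
  have key := measurable_measure_prodMk_left
    (ν := stdGaussian (EuclideanSpace ℝ (Fin n))) (hm hs)
  have e : (fun F : EuclideanSpace ℝ (Fin n) =>
      (stdGaussian (EuclideanSpace ℝ (Fin n))).map (fun x => F + L x) s) =
      fun F => stdGaussian (EuclideanSpace ℝ (Fin n))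
        (Prod.mk F ⁻¹' ((fun p : EuclideanSpace ℝ (Fin n) × EuclideanSpace ℝ (Fin n) =>
          p.1 + L p.2) ⁻¹' s)) := by
    funext F
    rw [Measure.map_apply (by fun_prop) hs]
    rfl
  rw [e]
  exact key

/-- The sampling model: given the mean vector `F`, the observation has law `N(F, σ² Iₙ)`. -/
def sampling (n : ℕ) (σ : ℝ) :
    Kernel (EuclideanSpace ℝ (Fin n)) (EuclideanSpace ℝ (Fin n)) where
  toFun F := multivariateGaussian F (σ ^ 2 • (1 : Matrix (Fin n) (Fin n) ℝ))
  measurable' := measurable_multivariateGaussian _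

instance (n : ℕ) (σ : ℝ) : IsMarkovKernel (sampling n σ) :=
  ⟨fun F => inferInstanceAs (IsProbabilityMeasure
    (multivariateGaussian F (σ ^ 2 • (1 : Matrix (Fin n) (Fin n) ℝ))))⟩

/-- The prior on the mean vector `F = Φ θ` induced by a prior on `θ`. -/
def inducedPrior {n k : ℕ} (Φ : Matrix (Fin n) (Fin k) ℝ)
    (Wt : Measure (EuclideanSpace ℝ (Fin k))) : Measure (EuclideanSpace ℝ (Fin n)) :=
  Wt.map (design Φ)

instance {n k : ℕ} (Φ : Matrix (Fin n) (Fin k) ℝ) (Wt : Measure (EuclideanSpace ℝ (Fin k)))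
    [IsFiniteMeasure Wt] : IsFiniteMeasure (inducedPrior Φ Wt) := by
  unfold inducedPrior; infer_instance

/-- The posterior distribution of `F` given `Y = y`, when `F` has the prior `W` and
`Y` has law `N(F, σ² Iₙ)` given `F`. -/
def posteriorF {n : ℕ} (σ : ℝ) (W : Measure (EuclideanSpace ℝ (Fin n))) [IsFiniteMeasure W]
    (y : EuclideanSpace ℝ (Fin n)) : Measure (EuclideanSpace ℝ (Fin n)) :=
  posterior (sampling n σ) W y

end

end GaussianRegression

/-!
The proof compares densities on the parameter space. Write `θ̂ = projParam Φ Y`,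
`θ₀ = projParam Φ F₀`, and let `g_t` be the density of `N(t, σ² (ΦᵀΦ)⁻¹)`, which is
`g_t(θ) = C exp (-‖Φ (θ - t)‖² / (2σ²))` with `C = √det(ΦᵀΦ) / (σ √(2π))^k` (`gaussDens`).
By Pythagoras (`norm_sub_design_sq`) the likelihood of `θ` is a multiple of `g_θ̂(θ)`, even when
the mean of `Y` is outside the column span. Hence the posterior is the image under `Φ` of the law
with density `w g_θ̂ / ∫ w g_θ̂` (`ae_posteriorF_eq`), and `N(Y_Φ, σ² Π)` is the image of the law with
density `g_θ̂` (`multivariateGaussian_projMatrix`).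

Let `B = {θ : ‖Φ (θ - θ₀)‖² ≤ σ² M}` and let `ρ` bound the ratios of the values of `w` on `B`. Then
`w ≤ ρ w(θ₀)` and `w(θ₀) ≤ ρ w` on `B`, and comparing the two densities there gives
(`withDensity_le_reweighted_add`)
`‖posterior - Gaussian‖ ≤ ∫_{Bᶜ} g_θ̂ + (ρ² - 1) + ρ ∫_{Bᶜ} w g_θ̂ / w(θ₀)`.
Since `θ̂` has density `g_{θ₀}`, the parallelogram law gives
`E g_θ̂(θ) ≤ C exp (-‖Φ (θ - θ₀)‖² / (4σ²))` (`lintegral_gaussDens_projParam_le`), so that by Tonelli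
the expectations of the two integrals over `Bᶜ` are at most `2^k exp (-M/8)` and
`√det(ΦᵀΦ) / σ^k * exp (-M/4)` (`lintegral_tvDist_le`). No restriction of `Y` to a typical set is
needed. The dimension condition gives `k = o(M)`, which kills the first term; flatness of the prior
gives `ρ → 1`; and the lower bound on `w(θ₀)` loses only a factor `exp (o(M))` in the last term.
-/

namespace GaussianRegression

/-! ### Linear algebra of the design -/

section Matrices

variable {n k : ℕ} {Φ : Matrix (Fin n) (Fin k) ℝ}

theorem posDef_gram (hΦ : LinearIndependent ℝ Φ.col) : (Φᵀ * Φ).PosDef := by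
  have h := (Matrix.PosDef.one (n := Fin n) (R := ℝ)).conjTranspose_mul_mul_same
    (B := Φ) (Matrix.mulVec_injective_iff.mpr hΦ)
  simpa [Matrix.conjTranspose_eq_transpose_of_trivial] using h

theorem toEuclideanLin_mul {l m n : ℕ} (A : Matrix (Fin l) (Fin m) ℝ)
    (B : Matrix (Fin m) (Fin n) ℝ) (x : EuclideanSpace ℝ (Fin n)) :
    Matrix.toEuclideanLin (A * B) x = Matrix.toEuclideanLin A (Matrix.toEuclideanLin B x) := by
  simp [Matrix.toLpLin_apply, Matrix.mulVec_mulVec]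

theorem inner_toEuclideanLin {m n : ℕ} (A : Matrix (Fin m) (Fin n) ℝ)
    (x : EuclideanSpace ℝ (Fin n)) (y : EuclideanSpace ℝ (Fin m)) :
    inner ℝ (Matrix.toEuclideanLin A x) y = inner ℝ x (Matrix.toEuclideanLin Aᵀ y) := by
  rw [← Matrix.conjTranspose_eq_transpose_of_trivial, Matrix.toEuclideanLin_conjTranspose_eq_adjoint,
    LinearMap.adjoint_inner_right]

theorem design_one {n : ℕ} (x : EuclideanSpace ℝ (Fin n)) :
    design (1 : Matrix (Fin n) (Fin n) ℝ) x = x := by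
  simp [design]

theorem design_projParam (y : EuclideanSpace ℝ (Fin n)) :
    design Φ (projParam Φ y) = Matrix.toEuclideanLin (projMatrix Φ) y := by
  rw [design, projParam, projMatrix, ← toEuclideanLin_mul, Matrix.mul_assoc]

/-- Pythagoras: the residual `y - Φ θ̂` is orthogonal to the column span of `Φ`. -/
theorem norm_sub_design_sq (hΦ : LinearIndependent ℝ Φ.col) (y : EuclideanSpace ℝ (Fin n))
    (θ : EuclideanSpace ℝ (Fin k)) :
    ‖y - design Φ θ‖ ^ 2 =
      ‖y - design Φ (projParam Φ y)‖ ^ 2 + ‖design Φ (θ - projParam Φ y)‖ ^ 2 := by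
  have hu : IsUnit (Φᵀ * Φ).det := (posDef_gram hΦ).det_pos.ne'.isUnit
  have horth : ∀ h, inner ℝ (y - design Φ (projParam Φ y)) (design Φ h) = 0 := by
    intro h
    rw [real_inner_comm, design, inner_toEuclideanLin, map_sub, ← toEuclideanLin_mul,
      projParam, ← toEuclideanLin_mul, ← Matrix.mul_assoc, Matrix.mul_nonsing_inv _ hu,
      Matrix.one_mul, sub_self, inner_zero_right]
  have e : y - design Φ θ = (y - design Φ (projParam Φ y)) - design Φ (θ - projParam Φ y) := by
    rw [map_sub]; abel
  rw [e, norm_sub_sq_real, horth]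
  ring

theorem parallelogram_design (Φ : Matrix (Fin n) (Fin k) ℝ) (θ t θ₀ : EuclideanSpace ℝ (Fin k)) :
    ‖design Φ (θ - t)‖ ^ 2 + ‖design Φ (t - θ₀)‖ ^ 2 =
      ‖design Φ (θ - θ₀)‖ ^ 2 / 2 + 2 * ‖design Φ (t - (2⁻¹ : ℝ) • (θ + θ₀))‖ ^ 2 := by
  have h := parallelogram_law_with_norm ℝ (design Φ (θ - t)) (design Φ (t - θ₀))
  have h1 : design Φ (θ - t) + design Φ (t - θ₀) = design Φ (θ - θ₀) := by
    rw [← map_add]; congr 1; abel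
  have h2 : design Φ (θ - t) - design Φ (t - θ₀) =
      (-2 : ℝ) • design Φ (t - (2⁻¹ : ℝ) • (θ + θ₀)) := by
    rw [← map_sub, ← map_smul]; congr 1; module
  rw [h1, h2, norm_smul, Real.norm_of_nonpos (by norm_num)] at h
  linarith

end Matrices

/-! ### Gaussian densities -/

section Density

/-- The image of a Gaussian law under a matrix. -/
theorem map_multivariateGaussian {m n : ℕ} (A : Matrix (Fin m) (Fin n) ℝ)
    (μ : EuclideanSpace ℝ (Fin n)) {S : Matrix (Fin n) (Fin n) ℝ} (hS : S.PosSemidef) :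
    (multivariateGaussian μ S).map (Matrix.toEuclideanLin A) =
      multivariateGaussian (Matrix.toEuclideanLin A μ) (A * S * Aᵀ) := by
  have hm : Measurable (Matrix.toEuclideanLin A) :=
    (LinearMap.continuous_of_finiteDimensional _).measurable
  have : IsProbabilityMeasure ((multivariateGaussian μ S).map (Matrix.toEuclideanLin A)) :=
    Measure.isProbabilityMeasure_map hm.aemeasurable
  have hS' : (A * S * Aᵀ).PosSemidef := by
    simpa [Matrix.conjTranspose_eq_transpose_of_trivial] using hS.mul_mul_conjTranspose_same A
  refine Measure.ext_of_charFun (funext fun t => ?_)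
  have h : charFun ((multivariateGaussian μ S).map (Matrix.toEuclideanLin A)) t =
      charFun (multivariateGaussian μ S) (Matrix.toEuclideanLin Aᵀ t) := by
    rw [charFun_apply, charFun_apply, integral_map hm.aemeasurable
      (Measurable.aestronglyMeasurable (by fun_prop))]
    simp_rw [inner_toEuclideanLin]
  rw [h, charFun_multivariateGaussian hS, charFun_multivariateGaussian hS',
    real_inner_comm, ← inner_toEuclideanLin, real_inner_comm]
  congr 4
  simp only [Matrix.toLpLin_apply]
  rw [← Matrix.mulVec_mulVec, ← Matrix.mulVec_mulVec, Matrix.dotProduct_mulVec t.ofLp A,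
    Matrix.mulVec_transpose]

/-- The standard Gaussian law has density `(2π)^{-k/2} exp (-‖x‖²/2)`. -/
theorem stdGaussian_eq_withDensity (k : ℕ) :
    stdGaussian (EuclideanSpace ℝ (Fin k)) = volume.withDensity fun x =>
      ENNReal.ofReal ((√(2 * Real.pi) ^ k)⁻¹ * Real.exp (-‖x‖ ^ 2 / 2)) := by
  set E := EuclideanSpace ℝ (Fin k)
  set c : ℝ := (√(2 * Real.pi) ^ k)⁻¹ with hc
  have hc0 : 0 ≤ c := by positivity
  have hint : Integrable (fun x : E => c * Real.exp (-‖x‖ ^ 2 / 2)) := by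
    have h := GaussianFourier.integrable_cexp_neg_mul_sq_norm_add (V := E) (b := 1 / 2)
      (by norm_num) 0 0
    have h2 := h.norm.const_mul c
    refine h2.congr (ae_of_all _ fun x => ?_)
    simp only [Complex.norm_exp]
    congr 2
    have e : (-(1 / 2) * (‖x‖ : ℂ) ^ 2 + 0 * ((inner ℝ (0 : E) x : ℝ) : ℂ)) =
        ((-‖x‖ ^ 2 / 2 : ℝ) : ℂ) := by
      push_cast
      ring
    rw [e, Complex.ofReal_re]
  have : IsFiniteMeasure (volume.withDensity fun x : E =>
      ENNReal.ofReal (c * Real.exp (-‖x‖ ^ 2 / 2))) :=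
    isFiniteMeasure_withDensity_ofReal hint.2
  refine Measure.ext_of_charFun (funext fun t => ?_)
  rw [charFun_stdGaussian, charFun_apply, integral_withDensity_eq_integral_toReal_smul
    (by fun_prop) (ae_of_all _ fun _ => ENNReal.ofReal_lt_top)]
  have h := GaussianFourier.integral_cexp_neg_mul_sq_norm_add (V := E) (b := 1 / 2)
      (by norm_num) Complex.I t
  have hpt : ∀ x : E, (ENNReal.ofReal (c * Real.exp (-‖x‖ ^ 2 / 2))).toReal •
      Complex.exp (inner ℝ x t * Complex.I) =
      c * Complex.exp (-(1 / 2) * ‖x‖ ^ 2 + Complex.I * inner ℝ t x) := by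
    intro x
    rw [ENNReal.toReal_ofReal (by positivity), Complex.real_smul, Complex.ofReal_mul, mul_assoc,
      Complex.ofReal_exp, ← Complex.exp_add, real_inner_comm]
    congr 2
    push_cast
    ring
  simp_rw [hpt]
  rw [integral_const_mul, h, Complex.I_sq]
  have h2 : ((Real.pi : ℂ) / (1 / 2)) ^ ((Module.finrank ℝ E : ℂ) / 2) =
      ((√(2 * Real.pi) ^ k : ℝ) : ℂ) := by
    have e1 : ((Real.pi : ℂ) / (1 / 2)) = ((2 * Real.pi : ℝ) : ℂ) := by push_cast; ring
    have e2 : ((Module.finrank ℝ E : ℂ) / 2) = ((k / 2 : ℝ) : ℂ) := by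
      simp [E]
    rw [e1, e2, ← Complex.ofReal_cpow (by positivity), Real.sqrt_eq_rpow, ← Real.rpow_natCast,
      ← Real.rpow_mul (by positivity)]
    congr 2
    ring
  rw [h2, ← mul_assoc, ← Complex.ofReal_mul, hc, inv_mul_cancel₀ (by positivity)]
  simp only [Complex.ofReal_one, one_mul]
  congr 1
  ring

/-- The density at `x` of the law `N(m, s² (ΦᵀΦ)⁻¹)` on the parameter space. It is symmetric in
`m` and `x`. For `Φ = 1` it is the density of the sampling model. -/
noncomputable def gaussDens {n k : ℕ} (Φ : Matrix (Fin n) (Fin k) ℝ) (s : ℝ)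
    (m x : EuclideanSpace ℝ (Fin k)) : ℝ≥0∞ :=
  ENNReal.ofReal (√(Φᵀ * Φ).det / (s * √(2 * Real.pi)) ^ k *
    Real.exp (-‖design Φ (x - m)‖ ^ 2 / (2 * s ^ 2)))

variable {n k : ℕ} {Φ : Matrix (Fin n) (Fin k) ℝ}

theorem measurable_design (Φ : Matrix (Fin n) (Fin k) ℝ) : Measurable (design Φ) :=
  (LinearMap.continuous_of_finiteDimensional _).measurable

theorem measurable_projParam (Φ : Matrix (Fin n) (Fin k) ℝ) : Measurable (projParam Φ) :=
  (LinearMap.continuous_of_finiteDimensional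
    (Matrix.toEuclideanLin ((Φᵀ * Φ)⁻¹ * Φᵀ))).measurable

theorem measurable_gaussDens_comp {α : Type*} [MeasurableSpace α] (Φ : Matrix (Fin n) (Fin k) ℝ)
    (s : ℝ) {f g : α → EuclideanSpace ℝ (Fin k)} (hf : Measurable f) (hg : Measurable g) :
    Measurable fun a => gaussDens Φ s (f a) (g a) := by
  have h : Measurable fun a => design Φ (g a - f a) := (measurable_design Φ).comp (hg.sub hf)
  unfold gaussDens
  fun_prop

theorem measurable_gaussDens (Φ : Matrix (Fin n) (Fin k) ℝ) (s : ℝ) :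
    Measurable (Function.uncurry (gaussDens Φ s)) :=
  measurable_gaussDens_comp Φ s measurable_fst measurable_snd

theorem measurable_gaussDens_right (Φ : Matrix (Fin n) (Fin k) ℝ) (s : ℝ)
    (m : EuclideanSpace ℝ (Fin k)) : Measurable (gaussDens Φ s m) :=
  measurable_gaussDens_comp Φ s measurable_const measurable_id

theorem measurable_gaussDens_left (Φ : Matrix (Fin n) (Fin k) ℝ) (s : ℝ)
    (x : EuclideanSpace ℝ (Fin k)) : Measurable fun m => gaussDens Φ s m x :=
  measurable_gaussDens_comp Φ s measurable_id measurable_const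

theorem gaussDens_pos (hΦ : LinearIndependent ℝ Φ.col) {s : ℝ} (hs : 0 < s)
    (m x : EuclideanSpace ℝ (Fin k)) : 0 < gaussDens Φ s m x := by
  have := (posDef_gram hΦ).det_pos
  refine ENNReal.ofReal_pos.mpr ?_
  positivity

theorem gaussDens_le (Φ : Matrix (Fin n) (Fin k) ℝ) {s : ℝ} (hs : 0 < s)
    (m x : EuclideanSpace ℝ (Fin k)) :
    gaussDens Φ s m x ≤ ENNReal.ofReal (√(Φᵀ * Φ).det / (s * √(2 * Real.pi)) ^ k) := by
  refine ENNReal.ofReal_le_ofReal (mul_le_of_le_one_right (by positivity) ?_)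
  refine Real.exp_le_one_iff.mpr (div_nonpos_of_nonpos_of_nonneg ?_ (by positivity))
  exact neg_nonpos.mpr (by positivity)

theorem posDef_smul_inv_gram (hΦ : LinearIndependent ℝ Φ.col) {s : ℝ} (hs : 0 < s) :
    (s ^ 2 • (Φᵀ * Φ)⁻¹).PosDef :=
  (posDef_gram hΦ).inv.smul (by positivity)

/-- The affine change of variables `x = m + Q z`. -/
theorem map_affine_withDensity {Q : Matrix (Fin k) (Fin k) ℝ} (hQ : Q.det ≠ 0)
    (m : EuclideanSpace ℝ (Fin k)) {g : EuclideanSpace ℝ (Fin k) → ℝ≥0∞} (hg : Measurable g) :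
    (volume.withDensity fun z => ENNReal.ofReal |Q.det| *
      g (m + Matrix.toEuclideanLin Q z)).map (fun z => m + Matrix.toEuclideanLin Q z) =
      volume.withDensity g := by
  have hldet : LinearMap.det (Matrix.toEuclideanLin Q) = Q.det := by
    exact (congrArg LinearMap.det (LinearMap.congr_fun (congrArg LinearEquiv.toLinearMap
      (Matrix.toLpLin_eq_toLin (n := Fin k) (m := Fin k) (R := ℝ) 2 2)) Q)).trans
      (LinearMap.det_toLin _ _)
  have hcont : Continuous (Matrix.toEuclideanLin Q) := LinearMap.continuous_of_finiteDimensional _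
  have hvol : (volume : Measure (EuclideanSpace ℝ (Fin k))).map
      (fun z => m + Matrix.toEuclideanLin Q z) = ENNReal.ofReal |Q.det⁻¹| • volume := by
    have h1 := Measure.map_linearMap_addHaar_eq_smul_addHaar
      (volume : Measure (EuclideanSpace ℝ (Fin k))) (f := Matrix.toEuclideanLin Q)
      (by rw [hldet]; exact hQ)
    have h2 : (fun z => m + Matrix.toEuclideanLin Q z) = (m + ·) ∘ Matrix.toEuclideanLin Q := rfl
    rw [h2, ← Measure.map_map (by fun_prop) hcont.measurable, h1, Measure.map_smul,
      map_add_left_eq_self, hldet]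
  have hmeas : Measurable fun z => m + Matrix.toEuclideanLin Q z := by fun_prop
  refine Measure.ext fun A hA => ?_
  rw [Measure.map_apply hmeas hA, withDensity_apply _ (hmeas hA), withDensity_apply _ hA,
    lintegral_const_mul _ (show Measurable fun z => g (m + Matrix.toEuclideanLin Q z) from
      hg.comp hmeas), ← setLIntegral_map hA hg hmeas, hvol,
    Measure.restrict_smul, lintegral_smul_measure, smul_eq_mul, ← mul_assoc,
    ← ENNReal.ofReal_mul (abs_nonneg _), ← abs_mul, mul_inv_cancel₀ hQ]
  simp

/-- If `Q` is symmetric with `Q² = s² (ΦᵀΦ)⁻¹`, then `s⁻¹ Φ Q` is an isometry. -/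
theorem norm_design_sqrt_sq (hΦ : LinearIndependent ℝ Φ.col) {s : ℝ} (hs : 0 < s)
    {Q : Matrix (Fin k) (Fin k) ℝ} (hQT : Qᵀ = Q) (hQQ : Q * Q = s ^ 2 • (Φᵀ * Φ)⁻¹)
    (z : EuclideanSpace ℝ (Fin k)) :
    ‖design Φ (Matrix.toEuclideanLin Q z)‖ ^ 2 = s ^ 2 * ‖z‖ ^ 2 := by
  have hQG : Q * ((s ^ 2)⁻¹ • (Q * (Φᵀ * Φ))) = 1 := by
    rw [Matrix.mul_smul, ← Matrix.mul_assoc, hQQ, Matrix.smul_mul, Matrix.nonsing_inv_mul _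
      (posDef_gram hΦ).det_pos.ne'.isUnit, smul_smul, inv_mul_cancel₀ (by positivity), one_smul]
  have hQGQ : Q * (Φᵀ * Φ) * Q = s ^ 2 • 1 := by
    have h := mul_eq_one_comm.mp hQG
    rw [Matrix.smul_mul] at h
    rw [← h, smul_smul, mul_inv_cancel₀ (by positivity), one_smul]
  rw [← real_inner_self_eq_norm_sq, design, inner_toEuclideanLin, inner_toEuclideanLin,
    ← toEuclideanLin_mul, ← toEuclideanLin_mul, ← toEuclideanLin_mul, hQT,
    Matrix.mul_assoc Q, hQGQ, map_smul, LinearMap.smul_apply, inner_smul_right,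
    ← real_inner_self_eq_norm_sq]
  simp

theorem abs_det_sqrt {s : ℝ} (hs : 0 < s) {Q : Matrix (Fin k) (Fin k) ℝ}
    (hQQ : Q * Q = s ^ 2 • (Φᵀ * Φ)⁻¹) : |Q.det| = s ^ k / √(Φᵀ * Φ).det := by
  have h := congrArg Matrix.det hQQ
  rw [Matrix.det_mul, Matrix.det_smul, Fintype.card_fin, Matrix.det_nonsing_inv,
    Ring.inverse_eq_inv'] at h
  rw [← Real.sqrt_mul_self_eq_abs, h, Real.sqrt_mul (by positivity), Real.sqrt_inv, ← pow_mul,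
    mul_comm 2 k, pow_mul, Real.sqrt_sq (by positivity), div_eq_mul_inv]

open scoped MatrixOrder in
/-- The square root in the definition of `multivariateGaussian`, by its defining properties. -/
theorem exists_eq_sqrt {S : Matrix (Fin k) (Fin k) ℝ} (hS : S.PosSemidef) :
    ∃ Q, CFC.sqrt S = Q ∧ Qᵀ = Q ∧ Q * Q = S := by
  refine ⟨_, rfl, ?_, CFC.sqrt_mul_sqrt_self _ hS.nonneg⟩
  have h : IsSelfAdjoint (CFC.sqrt S) := (CFC.sqrt_nonneg S).isSelfAdjoint
  rw [← Matrix.conjTranspose_eq_transpose_of_trivial]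
  exact h

/-- With `Q = (s² (ΦᵀΦ)⁻¹)^{1/2}`, the map `s⁻¹ Φ Q` is an isometry and `|det Q|` is known, so the
change of variables `x = m + Q z` carries the standard Gaussian density to `gaussDens Φ s m`. -/
theorem multivariateGaussian_eq_withDensity (hΦ : LinearIndependent ℝ Φ.col) {s : ℝ} (hs : 0 < s)
    (m : EuclideanSpace ℝ (Fin k)) :
    multivariateGaussian m (s ^ 2 • (Φᵀ * Φ)⁻¹) = volume.withDensity (gaussDens Φ s m) := by
  have hGd : 0 < (Φᵀ * Φ).det := (posDef_gram hΦ).det_pos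
  obtain ⟨Q, hQ, hQT, hQQ⟩ := exists_eq_sqrt (posDef_smul_inv_gram hΦ hs).posSemidef
  rw [multivariateGaussian, stdGaussian_eq_withDensity, hQ]
  have hdet := abs_det_sqrt hs hQQ
  have hdet0 : Q.det ≠ 0 := by
    rw [← abs_pos, hdet]
    positivity
  have hmap : (fun x => m + Matrix.toEuclideanCLM (n := Fin k) (𝕜 := ℝ) Q x) =
      fun x => m + Matrix.toEuclideanLin Q x := by
    funext x
    rw [← Matrix.coe_toEuclideanCLM_eq_toEuclideanLin]
    rfl
  have hdens : (fun z : EuclideanSpace ℝ (Fin k) =>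
      ENNReal.ofReal ((√(2 * Real.pi) ^ k)⁻¹ * Real.exp (-‖z‖ ^ 2 / 2))) =
      fun z => ENNReal.ofReal |Q.det| * gaussDens Φ s m (m + Matrix.toEuclideanLin Q z) := by
    funext z
    have hD : √(Φᵀ * Φ).det ≠ 0 := by positivity
    have hexp : -(s ^ 2 * ‖z‖ ^ 2) / (2 * s ^ 2) = -‖z‖ ^ 2 / 2 := by field_simp
    have hc : s ^ k / √(Φᵀ * Φ).det * (√(Φᵀ * Φ).det / (s * √(2 * Real.pi)) ^ k) =
        (√(2 * Real.pi) ^ k)⁻¹ := by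
      rw [mul_pow]
      field_simp
    rw [gaussDens, ← ENNReal.ofReal_mul (abs_nonneg _), add_sub_cancel_left,
      norm_design_sqrt_sq hΦ hs hQT hQQ, hdet, ← mul_assoc, hc, hexp]
  rw [hmap, hdens, map_affine_withDensity hdet0 m (measurable_gaussDens_right Φ s m)]

theorem lintegral_gaussDens (hΦ : LinearIndependent ℝ Φ.col) {s : ℝ} (hs : 0 < s)
    (m : EuclideanSpace ℝ (Fin k)) : ∫⁻ x, gaussDens Φ s m x = 1 := by
  have h := multivariateGaussian_eq_withDensity hΦ hs m
  have h1 : multivariateGaussian m (s ^ 2 • (Φᵀ * Φ)⁻¹) Set.univ = 1 := measure_univ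
  rwa [h, withDensity_apply _ MeasurableSet.univ, Measure.restrict_univ] at h1

theorem linearIndependent_one_col (n : ℕ) :
    LinearIndependent ℝ (1 : Matrix (Fin n) (Fin n) ℝ).col := by
  rw [← Matrix.mulVec_injective_iff]
  intro x y h
  simpa using h

theorem sampling_eq_withDensity {σ : ℝ} (hσ : 0 < σ) (F : EuclideanSpace ℝ (Fin n)) :
    sampling n σ F = volume.withDensity (gaussDens (1 : Matrix (Fin n) (Fin n) ℝ) σ F) := by
  rw [← multivariateGaussian_eq_withDensity (linearIndependent_one_col n) hσ]
  simp [sampling]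

/-- The law of the maximum likelihood estimator. -/
theorem map_projParam (hΦ : LinearIndependent ℝ Φ.col) (σ : ℝ) (F : EuclideanSpace ℝ (Fin n)) :
    (multivariateGaussian F (σ ^ 2 • (1 : Matrix (Fin n) (Fin n) ℝ))).map (projParam Φ) =
      multivariateGaussian (projParam Φ F) (σ ^ 2 • (Φᵀ * Φ)⁻¹) := by
  have hu : IsUnit (Φᵀ * Φ).det := (posDef_gram hΦ).det_pos.ne'.isUnit
  have h := map_multivariateGaussian ((Φᵀ * Φ)⁻¹ * Φᵀ) F
    (S := σ ^ 2 • (1 : Matrix (Fin n) (Fin n) ℝ)) (Matrix.PosSemidef.one.smul (sq_nonneg σ))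
  refine h.trans ?_
  rw [Matrix.mul_smul, Matrix.smul_mul, Matrix.mul_one, Matrix.transpose_mul,
    Matrix.transpose_transpose, Matrix.transpose_nonsing_inv, Matrix.transpose_mul,
    Matrix.transpose_transpose, Matrix.mul_assoc, ← Matrix.mul_assoc Φᵀ,
    Matrix.mul_nonsing_inv _ hu, Matrix.mul_one]
  rfl

/-- The limiting law `N(Y_Φ, σ² Π)` has a density in the parameter space. -/
theorem multivariateGaussian_projMatrix (hΦ : LinearIndependent ℝ Φ.col) {σ : ℝ} (hσ : 0 < σ)
    (y : EuclideanSpace ℝ (Fin n)) :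
    multivariateGaussian (Matrix.toEuclideanLin (projMatrix Φ) y) (σ ^ 2 • projMatrix Φ) =
      (volume.withDensity (gaussDens Φ σ (projParam Φ y))).map (design Φ) := by
  rw [← multivariateGaussian_eq_withDensity hΦ hσ, ← design_projParam, design,
    map_multivariateGaussian _ _ (posDef_smul_inv_gram hΦ hσ).posSemidef,
    Matrix.mul_smul, Matrix.smul_mul, projMatrix]

end Density

/-! ### Bayes' formula and total variation -/

section Bayes

variable {Ω X : Type*} [MeasurableSpace Ω] [MeasurableSpace X]

theorem comp_eq_withDensity (κ : Kernel Ω X) (μ : Measure Ω) [SFinite μ] (ν : Measure X)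
    [SFinite ν] {f : Ω → X → ℝ≥0∞} (hf : Measurable (Function.uncurry f))
    (hκ : ∀ ω, κ ω = ν.withDensity (f ω)) :
    κ ∘ₘ μ = ν.withDensity fun x => ∫⁻ ω, f ω x ∂μ := by
  refine Measure.ext fun A hA => ?_
  rw [Measure.bind_apply hA κ.aemeasurable, withDensity_apply _ hA]
  simp_rw [hκ, withDensity_apply _ hA]
  exact lintegral_lintegral_swap hf.aemeasurable

/-- Bayes' formula for a model dominated by `ν`, with densities `f ω`. -/
theorem posterior_eq_withDensity_div [StandardBorelSpace Ω] [Nonempty Ω]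
    [MeasurableSpace.CountableOrCountablyGenerated Ω X]
    (κ : Kernel Ω X) [IsFiniteKernel κ] (μ : Measure Ω) [IsFiniteMeasure μ] (ν : Measure X)
    [SFinite ν] {f : Ω → X → ℝ≥0∞} (hf : Measurable (Function.uncurry f))
    (hκ : ∀ ω, κ ω = ν.withDensity (f ω))
    (h0 : ∀ x, ∫⁻ ω, f ω x ∂μ ≠ 0) (htop : ∀ x, ∫⁻ ω, f ω x ∂μ ≠ ∞) :
    ∀ᵐ x ∂(κ ∘ₘ μ), posterior κ μ x =
      μ.withDensity fun ω => f ω x / ∫⁻ ω', f ω' x ∂μ := by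
  set m : X → ℝ≥0∞ := fun x => ∫⁻ ω, f ω x ∂μ with hm_def
  have hm : Measurable m := hf.lintegral_prod_left'
  have hcomp : κ ∘ₘ μ = ν.withDensity m := comp_eq_withDensity κ μ ν hf hκ
  have hfω : ∀ ω, Measurable (f ω) := fun ω => hf.comp measurable_prodMk_left
  have hfm : Measurable fun p : Ω × X => f p.1 p.2 / m p.2 :=
    hf.div (hm.comp measurable_snd)
  have hκ' : ∀ ω, κ ω = (κ ∘ₘ μ).withDensity fun x => f ω x / m x := by
    intro ω
    rw [hcomp, hκ]
    refine Eq.trans ?_ (withDensity_mul ν hm ((hfω ω).div hm))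
    congr 1
    funext x
    exact (ENNReal.mul_div_cancel (h0 x) (htop x)).symm
  have hac : ∀ᵐ ω ∂μ, κ ω ≪ κ ∘ₘ μ := by
    refine ae_of_all _ fun ω => ?_
    rw [hκ' ω]
    exact withDensity_absolutelyContinuous _ _
  have hrn : ∀ ω, ∀ᵐ x ∂(κ ∘ₘ μ),
      κ.rnDeriv (Kernel.const _ (κ ∘ₘ μ)) ω x = f ω x / m x := by
    intro ω
    have h1 := Kernel.rnDeriv_eq_rnDeriv_measure (κ := κ) (η := Kernel.const _ (κ ∘ₘ μ)) (a := ω)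
    have h2 := Measure.rnDeriv_withDensity (κ ∘ₘ μ) ((hfω ω).div hm)
    rw [Kernel.const_apply] at h1
    have h3 : (κ ω).rnDeriv (κ ∘ₘ μ) =ᵐ[κ ∘ₘ μ] fun x => f ω x / m x := by
      rw [hκ' ω]
      exact h2
    exact h1.trans h3
  have hrn' : ∀ᵐ x ∂(κ ∘ₘ μ), ∀ᵐ ω ∂μ,
      κ.rnDeriv (Kernel.const _ (κ ∘ₘ μ)) ω x = f ω x / m x := by
    rw [Measure.ae_ae_comm]
    · exact ae_of_all _ hrn
    · exact measurableSet_eq_fun ((Kernel.measurable_rnDeriv _ _).comp measurable_swap)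
        (hfm.comp measurable_swap)
  filter_upwards [posterior_eq_withDensity hac, hrn'] with x hx hx'
  rw [hx]
  exact withDensity_congr_ae hx'

end Bayes

section TotalVariation

variable {α : Type*} [MeasurableSpace α]

/-- For probability measures a one-sided bound on the measures of all events suffices, since it
may be applied to an event and to its complement. -/
theorem tvDist_le_of_forall_le_add (P Q : Measure α) [IsProbabilityMeasure P]
    [IsProbabilityMeasure Q] {ε : ℝ≥0∞} (h : ∀ A, MeasurableSet A → Q A ≤ P A + ε) :
    tvDist P Q ≤ ε := by
  rcases eq_or_ne ε ∞ with rfl | hε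
  · exact le_top
  have hreal : ∀ A, MeasurableSet A → Q.real A ≤ P.real A + ε.toReal := by
    intro A hA
    have := ENNReal.toReal_mono (by finiteness) (h A hA)
    rwa [ENNReal.toReal_add (by finiteness) hε] at this
  refine iSup₂_le fun A hA => ENNReal.ofReal_le_of_le_toReal (abs_le.mpr ⟨?_, ?_⟩)
  · linarith [hreal A hA]
  · have := hreal Aᶜ hA.compl
    rw [probReal_compl_eq_one_sub hA, probReal_compl_eq_one_sub hA] at this
    linarith

/-- Compare `Q = g dμ` with the reweighted probability measure `P = w g dμ / ∫ w g dμ`. If `w`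
varies on `B` by at most the factor `ρ` from the value `w₀`, then `g ≤ r • dP/dμ` on `B` with
`r = ρ (ρ + ∫_{Bᶜ} w g / w₀)`, so that `Q ≤ P + (r - 1) + Q Bᶜ`. -/
theorem withDensity_le_reweighted_add (μ : Measure α) {w g : α → ℝ≥0∞} (hw : Measurable w)
    (hg : Measurable g) (hg1 : ∫⁻ x, g x ∂μ = 1) (hD0 : ∫⁻ x, w x * g x ∂μ ≠ 0)
    (hDtop : ∫⁻ x, w x * g x ∂μ ≠ ∞) {B : Set α} (hB : MeasurableSet B) {w₀ ρ : ℝ≥0∞}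
    (hw₀ : w₀ ≠ 0) (hw₀' : w₀ ≠ ∞) (hle : ∀ x ∈ B, w x ≤ ρ * w₀) (hge : ∀ x ∈ B, w₀ ≤ ρ * w x)
    {A : Set α} (hA : MeasurableSet A) :
    μ.withDensity g A ≤ μ.withDensity (fun x => w x * g x / ∫⁻ x', w x' * g x' ∂μ) A +
      (μ.withDensity g Bᶜ + (ρ ^ 2 - 1) + ρ * ((∫⁻ x in Bᶜ, w x * g x ∂μ) / w₀)) := by
  set D := ∫⁻ x, w x * g x ∂μ with hD
  set T := (∫⁻ x in Bᶜ, w x * g x ∂μ) / w₀ with hT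
  set P := μ.withDensity (fun x => w x * g x / D) with hP
  have hwg : Measurable fun x => w x * g x := hw.mul hg
  have hP1 : P Set.univ = 1 := by
    rw [hP, withDensity_apply _ MeasurableSet.univ, Measure.restrict_univ]
    simp_rw [div_eq_mul_inv]
    rw [lintegral_mul_const _ hwg, ENNReal.mul_inv_cancel hD0 hDtop]
  have hDle : D ≤ w₀ * (ρ + T) := by
    rw [hD, ← lintegral_add_compl _ hB, mul_add, hT, ENNReal.mul_div_cancel hw₀ hw₀']
    refine add_le_add ?_ le_rfl
    calc ∫⁻ x in B, w x * g x ∂μ ≤ ∫⁻ x in B, (ρ * w₀) * g x ∂μ :=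
          setLIntegral_mono' hB fun x hx => mul_le_mul_left (hle x hx) _
      _ = (ρ * w₀) * ∫⁻ x in B, g x ∂μ := lintegral_const_mul _ hg
      _ ≤ (ρ * w₀) * 1 := by
          refine mul_le_mul_right ?_ _
          rw [← hg1]
          exact setLIntegral_le_lintegral _ _
      _ = w₀ * ρ := by rw [mul_one, mul_comm]
  set r := ρ * (ρ + T) with hr
  -- On `B` the normalizing constant satisfies `D ≤ w₀ (ρ + T) ≤ r w x`.
  have hgr : ∀ x ∈ B, g x ≤ r * (w x * g x / D) := by
    intro x hx
    have h1 : D ≤ r * w x := by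
      calc D ≤ w₀ * (ρ + T) := hDle
        _ ≤ (ρ * w x) * (ρ + T) := mul_le_mul_left (hge x hx) _
        _ = r * w x := by rw [hr]; ring
    calc g x = D * g x / D := by
          rw [mul_comm, ENNReal.mul_div_cancel_right hD0 hDtop]
      _ ≤ (r * w x) * g x / D := ENNReal.div_le_div_right (mul_le_mul_left h1 _) _
      _ = r * (w x * g x / D) := by rw [mul_assoc, mul_div_assoc]
  have hAB : μ.withDensity g (A ∩ B) ≤ P A + (r - 1) := by
    calc μ.withDensity g (A ∩ B) = ∫⁻ x in A ∩ B, g x ∂μ := withDensity_apply _ (hA.inter hB)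
      _ ≤ ∫⁻ x in A ∩ B, r * (w x * g x / D) ∂μ :=
          setLIntegral_mono' (hA.inter hB) fun x hx => hgr x hx.2
      _ = r * P (A ∩ B) := by
          rw [lintegral_const_mul _ (hwg.div_const _), hP, withDensity_apply _ (hA.inter hB)]
      _ ≤ (1 + (r - 1)) * P (A ∩ B) := mul_le_mul_left le_add_tsub _
      _ = P (A ∩ B) + (r - 1) * P (A ∩ B) := by rw [add_mul, one_mul]
      _ ≤ P A + (r - 1) * 1 := by
          refine add_le_add (measure_mono Set.inter_subset_left) (mul_le_mul_right ?_ _)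
          rw [← hP1]
          exact measure_mono (Set.subset_univ _)
      _ = P A + (r - 1) := by rw [mul_one]
  have hr1 : r - 1 ≤ (ρ ^ 2 - 1) + ρ * T := by
    rw [tsub_le_iff_right, hr, mul_add, ← sq, add_right_comm]
    exact add_le_add le_tsub_add le_rfl
  calc μ.withDensity g A ≤ μ.withDensity g (A ∩ B) + μ.withDensity g Bᶜ := by
        refine (measure_mono fun x hx => ?_).trans (measure_union_le _ _)
        by_cases hxB : x ∈ B
        · exact Or.inl ⟨hx, hxB⟩
        · exact Or.inr hxB
    _ ≤ (P A + ((ρ ^ 2 - 1) + ρ * T)) + μ.withDensity g Bᶜ :=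
        add_le_add (hAB.trans (add_le_add le_rfl hr1)) le_rfl
    _ = _ := by ring

end TotalVariation

/-! ### The posterior in the parameter space -/

section Posterior

variable {n k : ℕ} {Φ : Matrix (Fin n) (Fin k) ℝ}

/-- By Pythagoras the likelihood of `θ` given `y` is, up to a factor depending only on `y`, the
Gaussian density centred at the maximum likelihood estimator. -/
theorem exists_likelihood_eq (hΦ : LinearIndependent ℝ Φ.col) {σ : ℝ} (hσ : 0 < σ)
    (y : EuclideanSpace ℝ (Fin n)) :
    ∃ K : ℝ≥0∞, K ≠ 0 ∧ K ≠ ∞ ∧ ∀ θ : EuclideanSpace ℝ (Fin k),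
      gaussDens (1 : Matrix (Fin n) (Fin n) ℝ) σ (design Φ θ) y =
        K * gaussDens Φ σ (projParam Φ y) θ := by
  have hG : 0 < (Φᵀ * Φ).det := (posDef_gram hΦ).det_pos
  set c := √(Φᵀ * Φ).det / (σ * √(2 * Real.pi)) ^ k with hc
  have hc0 : 0 < c := by positivity
  set K : ℝ := (1 / (σ * √(2 * Real.pi)) ^ n) / c *
    Real.exp (-‖y - design Φ (projParam Φ y)‖ ^ 2 / (2 * σ ^ 2)) with hK
  have hK0 : 0 < K := by positivity
  refine ⟨ENNReal.ofReal K, (ENNReal.ofReal_pos.mpr hK0).ne', ENNReal.ofReal_ne_top, fun θ => ?_⟩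
  rw [gaussDens, gaussDens, ← ENNReal.ofReal_mul hK0.le, design_one, norm_sub_design_sq hΦ y θ,
    ← hc, hK, neg_add, add_div, Real.exp_add]
  simp only [Matrix.transpose_one, mul_one, Matrix.det_one, Real.sqrt_one]
  congr 1
  field_simp

theorem lintegral_prior_mul_gaussDens_ne_zero (hΦ : LinearIndependent ℝ Φ.col) {σ : ℝ}
    (hσ : 0 < σ) {w : EuclideanSpace ℝ (Fin k) → ℝ≥0} (hw : Measurable w)
    (hw1 : ∫⁻ θ, (w θ : ℝ≥0∞) = 1) (m : EuclideanSpace ℝ (Fin k)) :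
    ∫⁻ θ, (w θ : ℝ≥0∞) * gaussDens Φ σ m θ ≠ 0 := by
  intro h
  have hm : Measurable fun θ => (w θ : ℝ≥0∞) * gaussDens Φ σ m θ :=
    hw.coe_nnreal_ennreal.mul (measurable_gaussDens_right Φ σ m)
  rw [lintegral_eq_zero_iff hm] at h
  have h0 : ∫⁻ θ, (w θ : ℝ≥0∞) = 0 := by
    rw [lintegral_eq_zero_iff hw.coe_nnreal_ennreal]
    filter_upwards [h] with θ hθ
    exact (mul_eq_zero.mp hθ).resolve_right (gaussDens_pos hΦ hσ m θ).ne'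
  rw [h0] at hw1
  exact zero_ne_one hw1

theorem lintegral_prior_mul_gaussDens_ne_top (Φ : Matrix (Fin n) (Fin k) ℝ) {σ : ℝ}
    (hσ : 0 < σ) {w : EuclideanSpace ℝ (Fin k) → ℝ≥0} (hw : Measurable w)
    (hw1 : ∫⁻ θ, (w θ : ℝ≥0∞) = 1) (m : EuclideanSpace ℝ (Fin k)) :
    ∫⁻ θ, (w θ : ℝ≥0∞) * gaussDens Φ σ m θ ≠ ∞ := by
  refine ne_top_of_le_ne_top (ENNReal.ofReal_ne_top
    (r := √(Φᵀ * Φ).det / (σ * √(2 * Real.pi)) ^ k)) ?_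
  calc ∫⁻ θ, (w θ : ℝ≥0∞) * gaussDens Φ σ m θ
      ≤ ∫⁻ θ, (w θ : ℝ≥0∞) * ENNReal.ofReal (√(Φᵀ * Φ).det / (σ * √(2 * Real.pi)) ^ k) :=
        lintegral_mono fun θ => mul_le_mul_right (gaussDens_le Φ hσ m θ) _
    _ = _ := by rw [lintegral_mul_const _ hw.coe_nnreal_ennreal, hw1, one_mul]

/-- A density with respect to an image measure can be pulled back before taking the image. -/
theorem map_withDensity_comp {α β : Type*} [MeasurableSpace α] [MeasurableSpace β]
    (μ : Measure α) {T : α → β} (hT : Measurable T) {h : β → ℝ≥0∞} (hh : Measurable h) :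
    (μ.map T).withDensity h = (μ.withDensity (h ∘ T)).map T := by
  refine Measure.ext fun A hA => ?_
  rw [withDensity_apply _ hA, Measure.map_apply hT hA, withDensity_apply _ (hT hA),
    setLIntegral_map hA hh hT]
  rfl

/-- The posterior of `F = Φ θ` is the image of the law of `θ` whose density is the prior density
times the Gaussian density centred at the maximum likelihood estimator, normalized. The
posterior is determined only up to null sets of observations, here null for the sampling law. -/
theorem ae_posteriorF_eq (hΦ : LinearIndependent ℝ Φ.col) {σ : ℝ} (hσ : 0 < σ)
    (Wt : Measure (EuclideanSpace ℝ (Fin k))) [IsProbabilityMeasure Wt]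
    {w : EuclideanSpace ℝ (Fin k) → ℝ≥0} (hw : Measurable w)
    (hWt : Wt = volume.withDensity fun θ => (w θ : ℝ≥0∞)) (hw1 : ∫⁻ θ, (w θ : ℝ≥0∞) = 1)
    (F₀ : EuclideanSpace ℝ (Fin n)) :
    ∀ᵐ y ∂(sampling n σ F₀), posteriorF σ (inducedPrior Φ Wt) y =
      (volume.withDensity fun θ => (w θ : ℝ≥0∞) * gaussDens Φ σ (projParam Φ y) θ /
        ∫⁻ θ', (w θ' : ℝ≥0∞) * gaussDens Φ σ (projParam Φ y) θ').map (design Φ) := by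
  set f : EuclideanSpace ℝ (Fin n) → EuclideanSpace ℝ (Fin n) → ℝ≥0∞ :=
    gaussDens (1 : Matrix (Fin n) (Fin n) ℝ) σ with hf_def
  have hf : Measurable (Function.uncurry f) := measurable_gaussDens _ σ
  have hfy : ∀ y, Measurable fun F => f F y := fun y => measurable_gaussDens_left _ σ y
  have hD := measurable_design Φ
  have hwm := hw.coe_nnreal_ennreal
  have hg : ∀ y, Measurable (gaussDens Φ σ (projParam Φ y)) :=
    fun y => measurable_gaussDens_right Φ σ _
  choose K hK0 hKtop hK using exists_likelihood_eq (Φ := Φ) hΦ hσ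
  have hmarg : ∀ y, ∫⁻ F, f F y ∂(inducedPrior Φ Wt) =
      K y * ∫⁻ θ, (w θ : ℝ≥0∞) * gaussDens Φ σ (projParam Φ y) θ := by
    intro y
    rw [inducedPrior, lintegral_map (hfy y) hD, hWt]
    simp_rw [hf_def, hK]
    rw [lintegral_withDensity_eq_lintegral_mul _ hwm ((hg y).const_mul _),
      ← lintegral_const_mul _ (show Measurable fun θ => (w θ : ℝ≥0∞) *
        gaussDens Φ σ (projParam Φ y) θ from hwm.mul (hg y))]
    refine lintegral_congr fun θ => ?_
    simp only [Pi.mul_apply]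
    ring
  have hJ0 := fun y => lintegral_prior_mul_gaussDens_ne_zero hΦ hσ hw hw1 (projParam Φ y)
  have hJtop := fun y => lintegral_prior_mul_gaussDens_ne_top Φ hσ hw hw1 (projParam Φ y)
  have h0 : ∀ y, ∫⁻ F, f F y ∂(inducedPrior Φ Wt) ≠ 0 := by
    intro y
    rw [hmarg]
    exact mul_ne_zero (hK0 y) (hJ0 y)
  have htop : ∀ y, ∫⁻ F, f F y ∂(inducedPrior Φ Wt) ≠ ∞ := by
    intro y
    rw [hmarg]
    exact ENNReal.mul_ne_top (hKtop y) (hJtop y)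
  have hbayes := posterior_eq_withDensity_div (sampling n σ) (inducedPrior Φ Wt) volume hf
    (sampling_eq_withDensity hσ) h0 htop
  -- The marginal law of `Y` has a positive Lebesgue density, so its null sets are null for the
  -- true law of `Y`.
  have hac : sampling n σ F₀ ≪ (sampling n σ) ∘ₘ (inducedPrior Φ Wt) := by
    rw [comp_eq_withDensity (sampling n σ) (inducedPrior Φ Wt) volume hf
      (sampling_eq_withDensity hσ), sampling_eq_withDensity hσ]
    exact (withDensity_absolutelyContinuous _ _).trans
      (withDensity_absolutelyContinuous' (hf.lintegral_prod_left').aemeasurable (ae_of_all _ h0))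
  filter_upwards [hac.ae_le hbayes] with y hy
  rw [posteriorF, hy, hmarg y, inducedPrior, map_withDensity_comp Wt hD ((hfy y).div_const _), hWt,
    ← withDensity_mul _ hwm (((hfy y).div_const _).comp hD)]
  congr 2
  funext θ
  simp only [Pi.mul_apply, Function.comp_apply, hf_def, hK]
  rw [ENNReal.mul_div_mul_left _ _ (hK0 y) (hKtop y), mul_div_assoc]

end Posterior

/-! ### Averaging over the observation -/

section ExpectedRisk

variable {n k : ℕ} {Φ : Matrix (Fin n) (Fin k) ℝ}

/-- The parallelogram law bounds the product of two Gaussian densities by a Gaussian density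
centred at the midpoint. -/
theorem gaussDens_mul_le (Φ : Matrix (Fin n) (Fin k) ℝ) {s : ℝ} (hs : 0 < s)
    (θ₀ t θ : EuclideanSpace ℝ (Fin k)) :
    gaussDens Φ s t θ * gaussDens Φ s θ₀ t ≤
      ENNReal.ofReal (√(Φᵀ * Φ).det / (s * √(2 * Real.pi)) ^ k *
        Real.exp (-‖design Φ (θ - θ₀)‖ ^ 2 / (4 * s ^ 2))) *
      gaussDens Φ s ((2⁻¹ : ℝ) • (θ + θ₀)) t := by
  set c := √(Φᵀ * Φ).det / (s * √(2 * Real.pi)) ^ k with hc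
  have hc0 : 0 ≤ c := by positivity
  rw [gaussDens, gaussDens, gaussDens, ← hc, ← ENNReal.ofReal_mul (by positivity),
    ← ENNReal.ofReal_mul (by positivity), mul_mul_mul_comm,
    mul_mul_mul_comm c (Real.exp (-‖design Φ (θ - θ₀)‖ ^ 2 / (4 * s ^ 2))),
    ← Real.exp_add, ← Real.exp_add]
  refine ENNReal.ofReal_le_ofReal (mul_le_mul_of_nonneg_left (Real.exp_le_exp.mpr ?_)
    (by positivity))
  have h := parallelogram_design Φ θ t θ₀
  have hn : 0 ≤ ‖design Φ (t - (2⁻¹ : ℝ) • (θ + θ₀))‖ ^ 2 := by positivity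
  have e : -‖design Φ (θ - t)‖ ^ 2 / (2 * s ^ 2) + -‖design Φ (t - θ₀)‖ ^ 2 / (2 * s ^ 2) =
      -(‖design Φ (θ - t)‖ ^ 2 + ‖design Φ (t - θ₀)‖ ^ 2) / (2 * s ^ 2) := by ring
  have e' : -‖design Φ (θ - θ₀)‖ ^ 2 / (4 * s ^ 2) +
      -‖design Φ (t - (2⁻¹ : ℝ) • (θ + θ₀))‖ ^ 2 / (2 * s ^ 2) =
      -(‖design Φ (θ - θ₀)‖ ^ 2 / 2 + ‖design Φ (t - (2⁻¹ : ℝ) • (θ + θ₀))‖ ^ 2) /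
        (2 * s ^ 2) := by
    field_simp
    ring
  rw [e, e', h]
  gcongr
  linarith

/-- Under the true law of `Y`, the Gaussian density centred at the maximum likelihood estimator
has a mean with Gaussian tails around `θ₀`. -/
theorem lintegral_gaussDens_projParam_le (hΦ : LinearIndependent ℝ Φ.col) {σ : ℝ} (hσ : 0 < σ)
    (F₀ : EuclideanSpace ℝ (Fin n)) (θ : EuclideanSpace ℝ (Fin k)) :
    ∫⁻ y, gaussDens Φ σ (projParam Φ y) θ
        ∂(multivariateGaussian F₀ (σ ^ 2 • (1 : Matrix (Fin n) (Fin n) ℝ))) ≤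
      ENNReal.ofReal (√(Φᵀ * Φ).det / (σ * √(2 * Real.pi)) ^ k *
        Real.exp (-‖design Φ (θ - projParam Φ F₀)‖ ^ 2 / (4 * σ ^ 2))) := by
  have hgl : Measurable fun t => gaussDens Φ σ t θ :=
    measurable_gaussDens_left Φ σ θ
  rw [← lintegral_map hgl (measurable_projParam Φ), map_projParam hΦ,
    multivariateGaussian_eq_withDensity hΦ hσ,
    lintegral_withDensity_eq_lintegral_mul _ (measurable_gaussDens_right Φ σ _) hgl]
  simp only [Pi.mul_apply]
  calc _ ≤ ∫⁻ t, ENNReal.ofReal (√(Φᵀ * Φ).det / (σ * √(2 * Real.pi)) ^ k *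
        Real.exp (-‖design Φ (θ - projParam Φ F₀)‖ ^ 2 / (4 * σ ^ 2))) *
        gaussDens Φ σ ((2⁻¹ : ℝ) • (θ + projParam Φ F₀)) t := by
        refine lintegral_mono fun t => ?_
        rw [mul_comm]
        exact gaussDens_mul_le Φ hσ _ t θ
    _ = _ := by
        rw [lintegral_const_mul _ (measurable_gaussDens_right Φ σ _), lintegral_gaussDens hΦ hσ,
          mul_one]

/-- Integrated form over the parameter space. It is applied with `f = 1` to the mass that the
Gaussian approximation puts outside the ellipsoid, and with `f = w` to the corresponding part of
the normalizing constant of the posterior. -/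
theorem lintegral_lintegral_gaussDens_le (hΦ : LinearIndependent ℝ Φ.col) {σ : ℝ} (hσ : 0 < σ)
    (F₀ : EuclideanSpace ℝ (Fin n)) {f : EuclideanSpace ℝ (Fin k) → ℝ≥0∞} (hf : Measurable f)
    (B : Set (EuclideanSpace ℝ (Fin k))) :
    ∫⁻ y, (∫⁻ θ in B, f θ * gaussDens Φ σ (projParam Φ y) θ)
        ∂(multivariateGaussian F₀ (σ ^ 2 • (1 : Matrix (Fin n) (Fin n) ℝ))) ≤
      ∫⁻ θ in B, f θ * ENNReal.ofReal (√(Φᵀ * Φ).det / (σ * √(2 * Real.pi)) ^ k *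
        Real.exp (-‖design Φ (θ - projParam Φ F₀)‖ ^ 2 / (4 * σ ^ 2))) := by
  have hm : Measurable fun p : EuclideanSpace ℝ (Fin n) × EuclideanSpace ℝ (Fin k) =>
      gaussDens Φ σ (projParam Φ p.1) p.2 :=
    measurable_gaussDens_comp Φ σ ((measurable_projParam Φ).comp measurable_fst) measurable_snd
  rw [lintegral_lintegral_swap ((hf.comp measurable_snd).mul hm).aemeasurable]
  refine lintegral_mono fun θ => ?_
  rw [lintegral_const_mul _ (measurable_gaussDens_comp Φ σ (measurable_projParam Φ) measurable_const)]
  exact mul_le_mul_right (lintegral_gaussDens_projParam_le hΦ hσ F₀ θ) _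

end ExpectedRisk

/-! ### The nonasymptotic bound -/

section Oscillation

variable {k : ℕ} {w : EuclideanSpace ℝ (Fin k) → ℝ≥0} {θ₀ : EuclideanSpace ℝ (Fin k)}
  {E : Set (EuclideanSpace ℝ (Fin k))}

theorem div_le_oscRatio {h g : EuclideanSpace ℝ (Fin k)} (hh : h ∈ E) (hg : g ∈ E) :
    (w (θ₀ + h) : ℝ≥0∞) / w (θ₀ + g) ≤ oscRatio w θ₀ E :=
  le_iSup₂_of_le h hh (le_iSup₂_of_le (f := fun g _ => (w (θ₀ + h) : ℝ≥0∞) / w (θ₀ + g)) g hg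
    le_rfl)

theorem le_oscRatio_mul (hE : 0 ∈ E) (hw₀ : w θ₀ ≠ 0) {h : EuclideanSpace ℝ (Fin k)}
    (hh : h ∈ E) : (w (θ₀ + h) : ℝ≥0∞) ≤ oscRatio w θ₀ E * w θ₀ := by
  have h1 := div_le_oscRatio (w := w) (θ₀ := θ₀) hh hE
  rw [add_zero] at h1
  rwa [ENNReal.div_le_iff (by simpa using hw₀) ENNReal.coe_ne_top] at h1

theorem le_mul_oscRatio (hE : 0 ∈ E) (hρ : oscRatio w θ₀ E ≠ ∞)
    {h : EuclideanSpace ℝ (Fin k)} (hh : h ∈ E) :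
    (w θ₀ : ℝ≥0∞) ≤ oscRatio w θ₀ E * w (θ₀ + h) := by
  have h1 := div_le_oscRatio (w := w) (θ₀ := θ₀) hE hh
  rw [add_zero] at h1
  refine (ENNReal.div_le_iff_le_mul (Or.inr hρ) (Or.inl ENNReal.coe_ne_top)).mp h1

/-- A finite nonzero oscillation ratio forces the density to be positive at the centre: otherwise
some quotient with nonzero numerator has `w θ₀ = 0` as its denominator. -/
theorem ne_zero_of_oscRatio (hE : 0 ∈ E) (h0 : oscRatio w θ₀ E ≠ 0) (hρ : oscRatio w θ₀ E ≠ ∞) :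
    w θ₀ ≠ 0 := by
  intro hw₀
  refine h0 ?_
  have hz : ∀ h ∈ E, (w (θ₀ + h) : ℝ≥0∞) = 0 := by
    intro h hh
    by_contra hne
    have h1 := div_le_oscRatio (w := w) (θ₀ := θ₀) hh hE
    rw [add_zero, hw₀, ENNReal.coe_zero, ENNReal.div_zero hne] at h1
    exact hρ (top_le_iff.mp h1)
  rw [oscRatio]
  simp only [ENNReal.iSup_eq_zero]
  intro h hh g _
  rw [hz h hh, ENNReal.zero_div]

end Oscillation

section Bound

variable {n k : ℕ} {Φ : Matrix (Fin n) (Fin k) ℝ}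

/-- The Gaussian tail outside the ellipsoid, by comparison with the law of twice the standard
deviation. -/
theorem setLIntegral_gauss_tail_le (hΦ : LinearIndependent ℝ Φ.col) {σ : ℝ} (hσ : 0 < σ) (M : ℝ)
    (θ₀ : EuclideanSpace ℝ (Fin k)) {B : Set (EuclideanSpace ℝ (Fin k))} (hB : MeasurableSet B)
    (hBM : ∀ θ ∈ B, σ ^ 2 * M ≤ ‖design Φ (θ - θ₀)‖ ^ 2) :
    ∫⁻ θ in B, ENNReal.ofReal (√(Φᵀ * Φ).det / (σ * √(2 * Real.pi)) ^ k *
        Real.exp (-‖design Φ (θ - θ₀)‖ ^ 2 / (4 * σ ^ 2))) ≤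
      ENNReal.ofReal (2 ^ k * Real.exp (-M / 8)) := by
  calc _ ≤ ∫⁻ θ in B, ENNReal.ofReal (2 ^ k * Real.exp (-M / 8)) *
        gaussDens Φ (2 * σ) θ₀ θ := by
        refine setLIntegral_mono' hB fun θ hθ => ?_
        have h := hBM θ hθ
        rw [gaussDens, ← ENNReal.ofReal_mul (by positivity)]
        refine ENNReal.ofReal_le_ofReal ?_
        have hexp : Real.exp (-‖design Φ (θ - θ₀)‖ ^ 2 / (4 * σ ^ 2)) ≤
            Real.exp (-M / 8) * Real.exp (-‖design Φ (θ - θ₀)‖ ^ 2 / (2 * (2 * σ) ^ 2)) := by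
          rw [← Real.exp_add]
          refine Real.exp_le_exp.mpr ?_
          have e : -M / 8 + -‖design Φ (θ - θ₀)‖ ^ 2 / (2 * (2 * σ) ^ 2) -
              -‖design Φ (θ - θ₀)‖ ^ 2 / (4 * σ ^ 2) =
              (‖design Φ (θ - θ₀)‖ ^ 2 - σ ^ 2 * M) / (8 * σ ^ 2) := by
            field_simp
            ring
          have h2 : 0 ≤ (‖design Φ (θ - θ₀)‖ ^ 2 - σ ^ 2 * M) / (8 * σ ^ 2) :=
            div_nonneg (sub_nonneg.mpr h) (by positivity)
          linarith
        have hc : √(Φᵀ * Φ).det / (σ * √(2 * Real.pi)) ^ k =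
            2 ^ k * (√(Φᵀ * Φ).det / (2 * σ * √(2 * Real.pi)) ^ k) := by
          rw [mul_assoc 2, mul_pow 2]
          field_simp
        calc _ ≤ √(Φᵀ * Φ).det / (σ * √(2 * Real.pi)) ^ k * (Real.exp (-M / 8) *
              Real.exp (-‖design Φ (θ - θ₀)‖ ^ 2 / (2 * (2 * σ) ^ 2))) :=
              mul_le_mul_of_nonneg_left hexp (by positivity)
          _ = _ := by rw [hc]; ring
    _ ≤ ∫⁻ θ, ENNReal.ofReal (2 ^ k * Real.exp (-M / 8)) * gaussDens Φ (2 * σ) θ₀ θ :=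
        setLIntegral_le_lintegral _ _
    _ = _ := by
        rw [lintegral_const_mul _ (measurable_gaussDens_right Φ _ _),
          lintegral_gaussDens hΦ (by positivity), mul_one]

/-- The prior mass outside the ellipsoid is at most `1`, and there the averaged Gaussian density is
exponentially small in `M`. -/
theorem setLIntegral_prior_tail_le {σ : ℝ} (hσ : 0 < σ) (M : ℝ)
    {w : EuclideanSpace ℝ (Fin k) → ℝ≥0} (hw : Measurable w) (hw1 : ∫⁻ θ, (w θ : ℝ≥0∞) = 1)
    (θ₀ : EuclideanSpace ℝ (Fin k)) {B : Set (EuclideanSpace ℝ (Fin k))} (hB : MeasurableSet B)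
    (hBM : ∀ θ ∈ B, σ ^ 2 * M ≤ ‖design Φ (θ - θ₀)‖ ^ 2) :
    ∫⁻ θ in B, (w θ : ℝ≥0∞) * ENNReal.ofReal (√(Φᵀ * Φ).det / (σ * √(2 * Real.pi)) ^ k *
        Real.exp (-‖design Φ (θ - θ₀)‖ ^ 2 / (4 * σ ^ 2))) ≤
      ENNReal.ofReal (√(Φᵀ * Φ).det / σ ^ k * Real.exp (-M / 4)) := by
  have hpi : (1 : ℝ) ≤ √(2 * Real.pi) := by
    rw [Real.one_le_sqrt]
    linarith [Real.pi_gt_three]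
  calc _ ≤ ∫⁻ θ in B, (w θ : ℝ≥0∞) *
        ENNReal.ofReal (√(Φᵀ * Φ).det / σ ^ k * Real.exp (-M / 4)) := by
        refine setLIntegral_mono' hB fun θ hθ => mul_le_mul_right (ENNReal.ofReal_le_ofReal ?_) _
        have h := hBM θ hθ
        have hexp : -‖design Φ (θ - θ₀)‖ ^ 2 / (4 * σ ^ 2) ≤ -M / 4 := by
          rw [div_le_div_iff₀ (by positivity) (by norm_num)]
          linarith
        have hs : σ ≤ σ * √(2 * Real.pi) := le_mul_of_one_le_right hσ.le hpi
        gcongr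
    _ ≤ ∫⁻ θ, (w θ : ℝ≥0∞) *
        ENNReal.ofReal (√(Φᵀ * Φ).det / σ ^ k * Real.exp (-M / 4)) :=
        setLIntegral_le_lintegral _ _
    _ = _ := by rw [lintegral_mul_const _ hw.coe_nnreal_ennreal, hw1, one_mul]

theorem zero_mem_ellipsoid (Φ : Matrix (Fin n) (Fin k) ℝ) (σ : ℝ) {M : ℝ} (hM : 0 ≤ M) :
    0 ∈ ellipsoid Φ σ M := by
  change ‖design Φ 0‖ ^ 2 ≤ σ ^ 2 * M
  rw [map_zero, norm_zero, zero_pow two_ne_zero]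
  positivity

/-- A nonasymptotic bound on the expected distance between the posterior and its Gaussian
approximation, for a single design. -/
theorem lintegral_tvDist_le (hΦ : LinearIndependent ℝ Φ.col) {σ : ℝ} (hσ : 0 < σ)
    (F₀ : EuclideanSpace ℝ (Fin n))
    (Wt : Measure (EuclideanSpace ℝ (Fin k))) [IsProbabilityMeasure Wt]
    {w : EuclideanSpace ℝ (Fin k) → ℝ≥0} (hw : Measurable w)
    (hWt : Wt = volume.withDensity fun θ => (w θ : ℝ≥0∞)) {M : ℝ} (hM : 0 ≤ M) {ρ : ℝ≥0∞}
    (hosc : oscRatio w (projParam Φ F₀) (ellipsoid Φ σ M) = ρ) (hρ0 : ρ ≠ 0) (hρ : ρ ≠ ∞) :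
    ∫⁻ y, tvDist (posteriorF σ (inducedPrior Φ Wt) y)
        (multivariateGaussian (Matrix.toEuclideanLin (projMatrix Φ) y) (σ ^ 2 • projMatrix Φ))
        ∂(multivariateGaussian F₀ (σ ^ 2 • (1 : Matrix (Fin n) (Fin n) ℝ))) ≤
      ENNReal.ofReal (2 ^ k * Real.exp (-M / 8)) + (ρ ^ 2 - 1) +
        ρ * (ENNReal.ofReal (√(Φᵀ * Φ).det / σ ^ k * Real.exp (-M / 4)) /
          w (projParam Φ F₀)) := by
  set θ₀ := projParam Φ F₀ with hθ₀
  set ν := multivariateGaussian F₀ (σ ^ 2 • (1 : Matrix (Fin n) (Fin n) ℝ)) with hν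
  have hw1 : ∫⁻ θ, (w θ : ℝ≥0∞) = 1 := by
    have h1 : Wt Set.univ = 1 := measure_univ
    rwa [hWt, withDensity_apply _ MeasurableSet.univ, Measure.restrict_univ] at h1
  have hE : (0 : EuclideanSpace ℝ (Fin k)) ∈ ellipsoid Φ σ M :=
    zero_mem_ellipsoid Φ σ hM
  have hw₀ : w θ₀ ≠ 0 := ne_zero_of_oscRatio hE (hosc ▸ hρ0) (hosc ▸ hρ)
  have hw₀' : (w θ₀ : ℝ≥0∞) ≠ 0 := by simpa using hw₀
  set B : Set (EuclideanSpace ℝ (Fin k)) := {θ | θ - θ₀ ∈ ellipsoid Φ σ M} with hB_def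
  have hD := measurable_design Φ
  have hB : MeasurableSet B := by
    have hm : Measurable fun θ : EuclideanSpace ℝ (Fin k) => ‖design Φ (θ - θ₀)‖ ^ 2 :=
      ((hD.comp (measurable_id.sub_const θ₀)).norm).pow_const 2
    exact measurableSet_le hm measurable_const
  have hBM : ∀ θ ∈ Bᶜ, σ ^ 2 * M ≤ ‖design Φ (θ - θ₀)‖ ^ 2 := fun θ hθ =>
    (lt_of_not_ge (show ¬ ‖design Φ (θ - θ₀)‖ ^ 2 ≤ σ ^ 2 * M from hθ)).le
  have hle : ∀ θ ∈ B, (w θ : ℝ≥0∞) ≤ ρ * w θ₀ := by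
    intro θ hθ
    have h := le_oscRatio_mul hE hw₀ hθ
    rwa [hosc, add_sub_cancel] at h
  have hge : ∀ θ ∈ B, (w θ₀ : ℝ≥0∞) ≤ ρ * w θ := by
    intro θ hθ
    have h := le_mul_oscRatio hE (hosc ▸ hρ) hθ
    rwa [hosc, add_sub_cancel] at h
  have hpt : ∀ᵐ y ∂ν, tvDist (posteriorF σ (inducedPrior Φ Wt) y)
      (multivariateGaussian (Matrix.toEuclideanLin (projMatrix Φ) y) (σ ^ 2 • projMatrix Φ)) ≤
      (∫⁻ θ in Bᶜ, 1 * gaussDens Φ σ (projParam Φ y) θ) + (ρ ^ 2 - 1) +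
        ρ * ((∫⁻ θ in Bᶜ, (w θ : ℝ≥0∞) * gaussDens Φ σ (projParam Φ y) θ) / w θ₀) := by
    filter_upwards [ae_posteriorF_eq hΦ hσ Wt hw hWt hw1 F₀] with y hy
    have : IsProbabilityMeasure (posteriorF σ (inducedPrior Φ Wt) y) := by
      have : IsProbabilityMeasure (inducedPrior Φ Wt) :=
        Measure.isProbabilityMeasure_map hD.aemeasurable
      unfold posteriorF
      infer_instance
    refine tvDist_le_of_forall_le_add _ _ fun A hA => ?_
    rw [hy, multivariateGaussian_projMatrix hΦ hσ, Measure.map_apply hD hA,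
      Measure.map_apply hD hA]
    have h := withDensity_le_reweighted_add volume hw.coe_nnreal_ennreal
      (measurable_gaussDens_right Φ σ (projParam Φ y)) (lintegral_gaussDens hΦ hσ _)
      (lintegral_prior_mul_gaussDens_ne_zero hΦ hσ hw hw1 _)
      (lintegral_prior_mul_gaussDens_ne_top Φ hσ hw hw1 _) hB hw₀' ENNReal.coe_ne_top hle hge
      (hD hA)
    rw [withDensity_apply _ hB.compl] at h
    simpa only [one_mul] using h
  have hmeas : ∀ {f : EuclideanSpace ℝ (Fin k) → ℝ≥0∞}, Measurable f →
      Measurable fun y => ∫⁻ θ in Bᶜ, f θ * gaussDens Φ σ (projParam Φ y) θ := by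
    intro f hf
    have hm : Measurable fun p : EuclideanSpace ℝ (Fin n) × EuclideanSpace ℝ (Fin k) =>
        f p.2 * gaussDens Φ σ (projParam Φ p.1) p.2 :=
      (hf.comp measurable_snd).mul (measurable_gaussDens_comp Φ σ
        ((measurable_projParam Φ).comp measurable_fst) measurable_snd)
    exact hm.lintegral_prod_right'
  refine (lintegral_mono_ae hpt).trans ?_
  have hm1 := hmeas (f := fun _ => 1) measurable_const
  have hm2 := hmeas hw.coe_nnreal_ennreal
  rw [lintegral_add_left (hm1.add_const _), lintegral_add_left hm1, lintegral_const,
    lintegral_const_mul _ (hm2.div_const _), measure_univ, mul_one]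
  simp_rw [div_eq_mul_inv _ (w θ₀ : ℝ≥0∞)]
  rw [lintegral_mul_const _ hm2]
  gcongr
  · refine (lintegral_lintegral_gaussDens_le hΦ hσ F₀ measurable_const Bᶜ).trans ?_
    simp only [one_mul]
    exact setLIntegral_gauss_tail_le hΦ hσ M θ₀ hB.compl hBM
  · exact (lintegral_lintegral_gaussDens_le hΦ hσ F₀ hw.coe_nnreal_ennreal Bᶜ).trans
      (setLIntegral_prior_tail_le hσ M hw hw1 θ₀ hB.compl hBM)

end Bound

/-! ### The limit -/

/-- The additive constant covers `k ≤ 3`, where `log k` may vanish or be less than `1`. -/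
theorem natCast_le_three_add_mul_log (k : ℕ) : (k : ℝ) ≤ 3 + k * Real.log k := by
  rcases le_or_gt k 3 with h | h
  · have h1 : (k : ℝ) ≤ 3 := by exact_mod_cast h
    have h2 : 0 ≤ (k : ℝ) * Real.log k := mul_nonneg k.cast_nonneg (Real.log_natCast_nonneg k)
    linarith
  · have h1 : (3 : ℝ) ≤ k := by exact_mod_cast h.le
    have h2 : 1 ≤ Real.log k := by
      rw [Real.le_log_iff_exp_le (by linarith)]
      linarith [Real.exp_one_lt_d9]
    nlinarith

theorem two_pow_mul_exp_le {k : ℕ} {M : ℝ} (h : (k : ℝ) * Real.log k ≤ M / 16) :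
    2 ^ k * Real.exp (-M / 8) ≤ Real.exp (3 - M / 16) := by
  have h2 : (2 : ℝ) ^ k ≤ Real.exp k := by
    rw [← Real.exp_one_pow]
    exact pow_le_pow_left₀ (by norm_num) (by linarith [Real.exp_one_gt_d9]) k
  calc 2 ^ k * Real.exp (-M / 8) ≤ Real.exp k * Real.exp (-M / 8) := by gcongr
    _ = Real.exp (k + -M / 8) := (Real.exp_add _ _).symm
    _ ≤ Real.exp (3 - M / 16) :=
        Real.exp_le_exp.mpr (by linarith [natCast_le_three_add_mul_log k])

end GaussianRegression


theorem theorem2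
    (k : ℕ → ℕ)
    (σ : ℕ → ℝ) (hσ : ∀ n, 0 < σ n)
    (Φ : ∀ n, Matrix (Fin n) (Fin (k n)) ℝ)
    (hΦ : ∀ n, LinearIndependent ℝ (Φ n).col)
    (F₀ : ∀ n, EuclideanSpace ℝ (Fin n))
    (Wt : ∀ n, Measure (EuclideanSpace ℝ (Fin (k n)))) [∀ n, IsProbabilityMeasure (Wt n)]
    (w : ∀ n, EuclideanSpace ℝ (Fin (k n)) → ℝ≥0) (hw : ∀ n, Measurable (w n))
    (hWt : ∀ n, Wt n = volume.withDensity (fun θ => (w n θ : ℝ≥0∞)))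
    (M : ℕ → ℝ) (hM : Tendsto M atTop atTop)
    (h_flat : Tendsto
      (fun n => GaussianRegression.oscRatio (w n) (GaussianRegression.projParam (Φ n) (F₀ n))
        (GaussianRegression.ellipsoid (Φ n) (σ n) (M n)))
      atTop (𝓝 1))
    (h_dim : (fun n => (k n : ℝ) * Real.log (k n)) =o[atTop] M)
    (h_weight : (fun n => max 0 (Real.log
        (Real.sqrt ((Φ n)ᵀ * Φ n).det /
          (σ n ^ k n * (w n (GaussianRegression.projParam (Φ n) (F₀ n)) : ℝ))))) =o[atTop] M) :
    Tendsto
      (fun n => ∫⁻ y, GaussianRegression.tvDist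
          (GaussianRegression.posteriorF (σ n) (GaussianRegression.inducedPrior (Φ n) (Wt n)) y)
          (multivariateGaussian (Matrix.toEuclideanLin (GaussianRegression.projMatrix (Φ n)) y)
            (σ n ^ 2 • GaussianRegression.projMatrix (Φ n)))
        ∂(multivariateGaussian (F₀ n) (σ n ^ 2 • (1 : Matrix (Fin n) (Fin n) ℝ))))
      atTop (𝓝 0) := by
  set θ₀ := fun n => GaussianRegression.projParam (Φ n) (F₀ n) with hθ₀
  set ρ := fun n => GaussianRegression.oscRatio (w n) (θ₀ n)
    (GaussianRegression.ellipsoid (Φ n) (σ n) (M n)) with hρ_def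
  have hM0 : ∀ᶠ n in atTop, 0 ≤ M n := hM.eventually_ge_atTop 0
  have hρ0 : ∀ᶠ n in atTop, ρ n ≠ 0 := h_flat.eventually_ne one_ne_zero
  have hρtop : ∀ᶠ n in atTop, ρ n ≠ ∞ := h_flat.eventually_ne ENNReal.one_ne_top
  -- The rates `M / 16` and `M / 8` are smaller than the exponents `M / 8` and `M / 4` of the two
  -- exponential terms in the nonasymptotic bound.
  have hdim : ∀ᶠ n in atTop, (k n : ℝ) * Real.log (k n) ≤ M n / 16 := by
    filter_upwards [h_dim.bound (c := 1 / 16) (by norm_num), hM0] with n h hn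
    rw [Real.norm_of_nonneg hn] at h
    linarith [Real.le_norm_self ((k n : ℝ) * Real.log (k n))]
  have hweight : ∀ᶠ n in atTop, Real.log (√((Φ n)ᵀ * Φ n).det /
      (σ n ^ k n * (w n (θ₀ n) : ℝ))) ≤ M n / 8 := by
    filter_upwards [h_weight.bound (c := 1 / 8) (by norm_num), hM0] with n h hn
    rw [Real.norm_of_nonneg hn] at h
    have h1 := (le_max_right 0 _).trans ((Real.le_norm_self _).trans h)
    linarith
  have hbound : ∀ᶠ n in atTop, ∫⁻ y, GaussianRegression.tvDist
          (GaussianRegression.posteriorF (σ n) (GaussianRegression.inducedPrior (Φ n) (Wt n)) y)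
          (multivariateGaussian (Matrix.toEuclideanLin (GaussianRegression.projMatrix (Φ n)) y)
            (σ n ^ 2 • GaussianRegression.projMatrix (Φ n)))
        ∂(multivariateGaussian (F₀ n) (σ n ^ 2 • (1 : Matrix (Fin n) (Fin n) ℝ))) ≤
      ENNReal.ofReal (Real.exp (3 - M n / 16)) + (ρ n ^ 2 - 1) +
        ρ n * ENNReal.ofReal (Real.exp (-M n / 8)) := by
    filter_upwards [hM0, hρ0, hρtop, hdim, hweight] with n hn h0 htop hd hwt
    refine (GaussianRegression.lintegral_tvDist_le (hΦ n) (hσ n) (F₀ n) (Wt n) (hw n) (hWt n) hn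
      rfl h0 htop).trans ?_
    have hw₀ : w n (θ₀ n) ≠ 0 := GaussianRegression.ne_zero_of_oscRatio
      (GaussianRegression.zero_mem_ellipsoid (Φ n) (σ n) hn) h0 htop
    have hw₀' : (0 : ℝ) < w n (θ₀ n) := by positivity
    have hσn := hσ n
    have hG := (GaussianRegression.posDef_gram (hΦ n)).det_pos
    refine add_le_add (add_le_add ?_ le_rfl) (mul_le_mul_right ?_ _)
    · exact ENNReal.ofReal_le_ofReal (GaussianRegression.two_pow_mul_exp_le hd)
    · rw [← ENNReal.ofReal_coe_nnreal, ← ENNReal.ofReal_div_of_pos hw₀']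
      refine ENNReal.ofReal_le_ofReal ?_
      rw [Real.log_le_iff_le_exp (by positivity)] at hwt
      calc _ = √((Φ n)ᵀ * Φ n).det / (σ n ^ k n * (w n (θ₀ n) : ℝ)) * Real.exp (-M n / 4) := by
            field_simp
        _ ≤ Real.exp (M n / 8) * Real.exp (-M n / 4) := by gcongr
        _ = Real.exp (-M n / 8) := by
            rw [← Real.exp_add]
            congr 1
            ring
  have hexp1 : Tendsto (fun n => ENNReal.ofReal (Real.exp (3 - M n / 16))) atTop (𝓝 0) := by
    rw [← ENNReal.ofReal_zero]
    refine ENNReal.tendsto_ofReal (Real.tendsto_exp_atBot.comp ?_)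
    exact tendsto_const_nhds.add_atBot
      (tendsto_neg_atTop_atBot.comp (hM.atTop_div_const (by norm_num)))
  have hexp2 : Tendsto (fun n => ENNReal.ofReal (Real.exp (-M n / 8))) atTop (𝓝 0) := by
    rw [← ENNReal.ofReal_zero]
    refine ENNReal.tendsto_ofReal (Real.tendsto_exp_atBot.comp ?_)
    exact (tendsto_neg_atTop_atBot.comp hM).atBot_div_const (by norm_num)
  have hosc : Tendsto (fun n => ρ n ^ 2 - 1) atTop (𝓝 0) := by
    have h := ENNReal.Tendsto.sub (ENNReal.Tendsto.pow (n := 2) h_flat) (tendsto_const_nhds (x := (1 : ℝ≥0∞)))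
      (Or.inr ENNReal.one_ne_top)
    simpa using h
  have hprod : Tendsto (fun n => ρ n * ENNReal.ofReal (Real.exp (-M n / 8))) atTop (𝓝 0) := by
    have h := ENNReal.Tendsto.mul h_flat (Or.inl one_ne_zero) hexp2 (Or.inr ENNReal.one_ne_top)
    simpa using h
  have hlim := (hexp1.add hosc).add hprod
  simp only [add_zero] at hlim
  exact tendsto_of_tendsto_of_tendsto_of_le_of_le' tendsto_const_nhds hlim
    (Eventually.of_forall fun _ => zero_le) hbound
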